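/- For a power series $S\in\mathbb{Z}[[t]]$, let $[S]$ denote the series obtained by truncating $S$ just before the index of its first nonpositive coefficient (with $[S]=S$ if all coefficients are positive). For integers $n,m\ge 0$ put $$\mathsf{HS}_{n,m}(t):=\left[\frac{(1+t)^n}{(1-t)(1+t^2)^m}\right].$$ Let $\alpha\ge 1$ be a real number. Then $\mathsf{HS}_{n,\lceil\alpha n\rceil}(t)$ is a polynomial for every integer $n\ge 1$ and, as $n\to\infty$, $$\deg\bigl(\mathsf{HS}_{n,\lceil \alpha n\rceil}(t)\bigr)\sim M(\alpha)\,n,$$ where $$M(x):=-x+\frac12+\frac12\sqrt{2x^2-10x-1+2(x+2)\sqrt{x(x+2)}}.$$ -/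

import Mathlib

open Filter Topology Asymptotics

/-- The series `[S]` obtained from `S ∈ ℤ⟦t⟧` by truncating it just before the index of its
first nonpositive coefficient (`[S] = S` if all the coefficients of `S` are positive): the
coefficient of index `d` is kept exactly when the coefficients of index `0, …, d` are all
positive. -/
noncomputable def posTrunc (S : PowerSeries ℤ) : PowerSeries ℤ :=
  open Classical in
  PowerSeries.mk fun d =>
    if ∀ i ≤ d, 0 < PowerSeries.coeff i S then PowerSeries.coeff d S else 0

/-- The power series `(1 + t) ^ n / ((1 - t) * (1 + t ^ 2) ^ m)` with integer coefficients. The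
denominator has constant coefficient `1`, hence is invertible in `ℤ⟦t⟧`. -/
noncomputable def fullSeries (n m : ℕ) : PowerSeries ℤ :=
  (1 + PowerSeries.X) ^ n *
    PowerSeries.invOfUnit ((1 - PowerSeries.X) * (1 + PowerSeries.X ^ 2) ^ m) 1

/-- `fullSeries n m` is the quotient that it is meant to be. -/
theorem fullSeries_mul_denom (n m : ℕ) :
    fullSeries n m * ((1 - PowerSeries.X) * (1 + PowerSeries.X ^ 2) ^ m) =
      (1 + PowerSeries.X) ^ n := by
  rw [fullSeries, mul_assoc, mul_comm (PowerSeries.invOfUnit _ _),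
    PowerSeries.mul_invOfUnit _ _ (by simp), mul_one]

/-- `HS_{n,m}(t) = [(1 + t) ^ n / ((1 - t) * (1 + t ^ 2) ^ m)]`. -/
noncomputable def truncHS (n m : ℕ) : PowerSeries ℤ :=
  posTrunc (fullSeries n m)

/-- `M(x) = -x + 1/2 + 1/2 * √(2 x² - 10 x - 1 + 2 (x + 2) √(x (x + 2)))`. -/
noncomputable def growthM (x : ℝ) : ℝ :=
  -x + 1 / 2 +
    1 / 2 * Real.sqrt (2 * x ^ 2 - 10 * x - 1 + 2 * (x + 2) * Real.sqrt (x * (x + 2)))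

/-! Let b_k be the coefficients of (1+t)^n/(1+t²)^m; those of the full series are their partial
sums. A differential equation gives a recurrence for b_k. While positive, the b_k at least double,
so partial sums stay below 2b_k, and soon after the first b_K ≤ 0 the recurrence drives the sum
nonpositive: for n ≥ 7 the degree is K - 1 or K (`coeff_fullSeries_succ_nonpos`).

To locate K, put y = b_k/b_{k+1} and k ≈ δn. To leading order, a stationary ratio y is a root of
`saddleCubic α δ`, and M(α) is the δ at which two positive roots merge into a double root τ. Below
M(α)n the bound y ≤ τ propagates (`quotCoeff_pos_of_le`); above it y must keep growing, against y ≤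
1/2 from doubling (`exists_quotCoeff_nonpos_of_le`). -/

/-! ### The coefficients of `(1 + t) ^ n / (1 + t ^ 2) ^ m` -/

/-- The `k`-th coefficient of `(1 + t) ^ n / (1 + t ^ 2) ^ m`. -/
noncomputable def quotCoeff (n m k : ℕ) : ℤ :=
  PowerSeries.coeff k (fullSeries n m * (1 - PowerSeries.X))

theorem fullSeries_one_sub_mul (n m : ℕ) :
    fullSeries n m * (1 - PowerSeries.X) * (1 + PowerSeries.X ^ 2) ^ m =
      (1 + PowerSeries.X) ^ n := by
  rw [mul_assoc, fullSeries_mul_denom]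

theorem coeff_zero_fullSeries (n m : ℕ) : PowerSeries.coeff 0 (fullSeries n m) = 1 := by
  have h := congrArg (PowerSeries.coeff 0) (fullSeries_mul_denom n m)
  simpa using h

theorem quotCoeff_zero (n m : ℕ) : quotCoeff n m 0 = 1 := by
  have h := coeff_zero_fullSeries n m
  simpa [quotCoeff] using h

theorem coeff_succ_fullSeries (n m k : ℕ) :
    PowerSeries.coeff (k + 1) (fullSeries n m) =
      PowerSeries.coeff k (fullSeries n m) + quotCoeff n m (k + 1) := by
  simp [quotCoeff, mul_sub, PowerSeries.coeff_succ_mul_X]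

/-- The differential equation satisfied by `F = (1 + t) ^ n / (1 + t ^ 2) ^ m`. -/
theorem one_add_mul_derivative (n m : ℕ) (F : PowerSeries ℤ)
    (hF : F * (1 + PowerSeries.X ^ 2) ^ m = (1 + PowerSeries.X) ^ n) :
    (1 + PowerSeries.X) * (1 + PowerSeries.X ^ 2) * PowerSeries.derivative ℤ F =
      ((n : PowerSeries ℤ) * (1 + PowerSeries.X ^ 2) -
        2 * (m : PowerSeries ℤ) * PowerSeries.X * (1 + PowerSeries.X)) * F := by
  have hne : ((1 : PowerSeries ℤ) + PowerSeries.X ^ 2) ^ m ≠ 0 := by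
    refine pow_ne_zero _ fun h => ?_
    simpa using congrArg (PowerSeries.coeff 0) h
  have hd := congrArg (PowerSeries.derivative ℤ) hF
  simp only [Derivation.leibniz, Derivation.leibniz_pow, map_add, Derivation.map_one_eq_zero,
    PowerSeries.derivative_X, smul_eq_mul, nsmul_eq_mul] at hd
  -- The extra factor removes the truncated exponent n - 1, so n = 0 needs no exception later.
  have hn : (n : PowerSeries ℤ) * (1 + (PowerSeries.X : PowerSeries ℤ)) ^ (n - 1) * (1 + PowerSeries.X) =
      (n : PowerSeries ℤ) * (1 + PowerSeries.X) ^ n := by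
    cases n with
    | zero => simp
    | succ n => simp [pow_succ, mul_assoc]
  have hm : (m : PowerSeries ℤ) * (1 + (PowerSeries.X : PowerSeries ℤ) ^ 2) ^ (m - 1) * (1 + PowerSeries.X ^ 2) =
      (m : PowerSeries ℤ) * (1 + PowerSeries.X ^ 2) ^ m := by
    cases m with
    | zero => simp
    | succ m => simp [pow_succ, mul_assoc]
  apply mul_left_cancel₀ hne
  simp only [zero_add, mul_one, Nat.cast_ofNat, Nat.add_one_sub_one, pow_one] at hd
  linear_combination (1 + PowerSeries.X) * (1 + PowerSeries.X ^ 2) * hd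
    - 2 * F * PowerSeries.X * (1 + PowerSeries.X) * hm + (1 + PowerSeries.X ^ 2) * hn
    - (n : PowerSeries ℤ) * (1 + PowerSeries.X ^ 2) * hF

theorem quotCoeff_derivative (n m : ℕ) :
    (1 + PowerSeries.X + PowerSeries.X ^ 2 + PowerSeries.X ^ 3) *
        PowerSeries.derivative ℤ (fullSeries n m * (1 - PowerSeries.X)) =
      (PowerSeries.C (n : ℤ) - PowerSeries.C (2 * m : ℤ) * PowerSeries.X +
        PowerSeries.C (n - 2 * m : ℤ) * PowerSeries.X ^ 2) *
          (fullSeries n m * (1 - PowerSeries.X)) := by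
  have h := one_add_mul_derivative n m _ (fullSeries_one_sub_mul n m)
  simp only [map_sub, map_mul, map_natCast, map_ofNat]
  linear_combination h

theorem quotCoeff_one (n m : ℕ) : quotCoeff n m 1 = n := by
  have h := congrArg (PowerSeries.coeff 0) (quotCoeff_derivative n m)
  have h0 := quotCoeff_zero n m
  simp only [quotCoeff] at h0 ⊢
  generalize fullSeries n m * (1 - PowerSeries.X) = F at h h0 ⊢
  simp only [add_mul, sub_mul, mul_assoc, one_mul, map_add, map_sub, PowerSeries.coeff_C_mul,
    PowerSeries.coeff_X_pow_mul', PowerSeries.coeff_derivative, PowerSeries.coeff_zero_X_mul,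
    h0] at h
  simpa using h

theorem quotCoeff_two (n m : ℕ) :
    2 * quotCoeff n m 2 = ((n : ℤ) - 1) * quotCoeff n m 1 - 2 * m * quotCoeff n m 0 := by
  have h := congrArg (PowerSeries.coeff (0 + 1)) (quotCoeff_derivative n m)
  simp only [quotCoeff]
  generalize fullSeries n m * (1 - PowerSeries.X) = F at h ⊢
  simp only [add_mul, sub_mul, mul_assoc, one_mul, map_add, map_sub, PowerSeries.coeff_C_mul,
    PowerSeries.coeff_X_pow_mul', PowerSeries.coeff_derivative, PowerSeries.coeff_succ_X_mul] at h
  norm_num at h ⊢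
  linear_combination h

theorem quotCoeff_recurrence (n m k : ℕ) :
    ((k : ℤ) + 3) * quotCoeff n m (k + 3) =
      ((n : ℤ) - (k + 2)) * quotCoeff n m (k + 2) - (2 * m + k + 1) * quotCoeff n m (k + 1) -
        (2 * m - n + k) * quotCoeff n m k := by
  have h := congrArg (PowerSeries.coeff (k + 1 + 1)) (quotCoeff_derivative n m)
  simp only [quotCoeff]
  generalize fullSeries n m * (1 - PowerSeries.X) = F at h ⊢
  simp only [add_mul, sub_mul, mul_assoc, one_mul, map_add, map_sub, PowerSeries.coeff_C_mul,
    PowerSeries.coeff_X_pow_mul', PowerSeries.coeff_derivative, PowerSeries.coeff_succ_X_mul] at h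
  rcases k with _ | k
  · norm_num at h ⊢
    linear_combination h
  · have h1 : k + 1 + 1 + 1 - 3 = k := by lia
    have h2 : k + 1 + 1 + 1 - 2 = k + 1 := by lia
    have h3 : 3 ≤ k + 1 + 1 + 1 := by lia
    have h4 : 2 ≤ k + 1 + 1 + 1 := by lia
    simp only [h1, h2, h3, h4, if_true] at h
    push_cast at h ⊢
    linear_combination h

/-! ### Sign changes of the coefficients -/

theorem quotCoeff_add_two_le {n m k : ℕ} (hnm : n ≤ m) (hpos : ∀ i < k, 0 ≤ quotCoeff n m i) :
    ((k : ℤ) + 2) * quotCoeff n m (k + 2) ≤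
      ((n : ℤ) - (k + 1)) * quotCoeff n m (k + 1) - (2 * m + k) * quotCoeff n m k := by
  rcases k with _ | k
  · have h := quotCoeff_two n m
    push_cast
    linarith
  · have h := quotCoeff_recurrence n m k
    have h0 : 0 ≤ (2 * (m : ℤ) - n + k) * quotCoeff n m k :=
      mul_nonneg (by lia) (hpos k (by lia))
    push_cast
    linarith

/-- While the coefficients stay positive they at least double. -/
theorem two_mul_quotCoeff_le {n m k : ℕ} (hn : 1 ≤ n) (hnm : n ≤ m)
    (hpos : ∀ i ≤ k + 2, 0 < quotCoeff n m i) :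
    2 * quotCoeff n m k ≤ quotCoeff n m (k + 1) := by
  have h := quotCoeff_add_two_le hnm fun i (hi : i < k) => (hpos i (by lia)).le
  have h0 := hpos k (by lia)
  have h1 := hpos (k + 1) (by lia)
  -- Positivity two indices ahead forces n·b_{k+1} ≥ 2m·b_k.
  have h2 := mul_pos (show (0 : ℤ) < k + 2 by positivity) (hpos (k + 2) le_rfl)
  have h3 : 0 ≤ ((k : ℤ) + 1) * quotCoeff n m (k + 1) := by positivity
  have h4 : 0 ≤ (k : ℤ) * quotCoeff n m k := by positivity
  have h5 : (n : ℤ) * quotCoeff n m k ≤ m * quotCoeff n m k := by gcongr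
  have h6 : (n : ℤ) * (2 * quotCoeff n m k) ≤ n * quotCoeff n m (k + 1) := by linarith
  exact le_of_mul_le_mul_left h6 (by lia)

/-- Two consecutive recurrence inequalities multiply to (k+2)(2n+k+1) < (n-k-1)(n-k-2), that is 4k +
7 < n. This crude bound K ≲ n/4 supplies K + 4 ≤ n below. -/
theorem exists_quotCoeff_nonpos {n m k : ℕ} (hn : 1 ≤ n) (hnm : n ≤ m) (hk : n ≤ 4 * k + 7) :
    ∃ i ≤ k + 3, quotCoeff n m i ≤ 0 := by
  by_contra! hpos
  have hA := quotCoeff_add_two_le (k := k) hnm fun i hi => (hpos i (by lia)).le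
  have hB := quotCoeff_add_two_le (k := k + 1) hnm fun i hi => (hpos i (by lia)).le
  have h0 := hpos k (by lia)
  have h1 := hpos (k + 1) (by lia)
  have h2 := hpos (k + 2) (by lia)
  have h3 := hpos (k + 3) (by lia)
  simp only [add_assoc, Nat.reduceAdd] at hA hB
  push_cast at hA hB
  generalize quotCoeff n m k = b0 at *
  generalize quotCoeff n m (k + 1) = b1 at *
  generalize quotCoeff n m (k + 2) = b2 at *
  generalize quotCoeff n m (k + 3) = b3 at *
  have h3' : 0 < ((k : ℤ) + (1 + 2)) * b3 := by positivity
  have hA' : ((k : ℤ) + 2) * b2 < (n - (k + 1)) * b1 := by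
    have : 0 < (2 * (m : ℤ) + k) * b0 := mul_pos (by lia) h0
    linarith
  have hB' : (2 * (n : ℤ) + k + 1) * b1 < (n - (k + 2)) * b2 := by
    have : (2 * (n : ℤ) + k + 1) * b1 ≤ (2 * m + (k + 1)) * b1 := by gcongr ?_ * b1; lia
    linarith
  have hc : (0 : ℤ) < n - (k + 2) := by
    have : 0 < (2 * (n : ℤ) + k + 1) * b1 := by positivity
    exact pos_of_mul_pos_left (this.trans hB') h2.le
  have hC := mul_lt_mul_of_pos_left hA' hc
  have hD := mul_lt_mul_of_pos_left hB' (show (0 : ℤ) < k + 2 by positivity)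
  have hE : ((k : ℤ) + 2) * (2 * n + k + 1) * b1 < (n - (k + 2)) * (n - (k + 1)) * b1 := by
    linarith
  have hF := lt_of_mul_lt_mul_right hE h1.le
  have hk' : (n : ℤ) ≤ 4 * k + 7 := by exact_mod_cast hk
  nlinarith

theorem coeff_fullSeries_le {n m K : ℕ} (hn : 1 ≤ n) (hnm : n ≤ m)
    (hpos : ∀ i < K, 0 < quotCoeff n m i) (k : ℕ) (hk : k + 2 ≤ K) :
    PowerSeries.coeff k (fullSeries n m) ≤ 2 * quotCoeff n m k := by
  induction k with
  | zero => simp [coeff_zero_fullSeries, quotCoeff_zero]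
  | succ k ih =>
    have h := two_mul_quotCoeff_le (k := k) hn hnm fun i hi => hpos i (by lia)
    have := ih (by lia)
    rw [coeff_succ_fullSeries]
    linarith

theorem coeff_fullSeries_pos {n m k : ℕ} (hpos : ∀ i ≤ k, 0 < quotCoeff n m i) :
    0 < PowerSeries.coeff k (fullSeries n m) := by
  induction k with
  | zero => simp [coeff_zero_fullSeries]
  | succ k ih =>
    rw [coeff_succ_fullSeries]
    have := ih fun i hi => hpos i (by lia)
    have := hpos (k + 1) le_rfl
    linarith

/-- If the first nonpositive coefficient of `(1 + t) ^ n / (1 + t ^ 2) ^ m` has index `K`, then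
the partial sums of the coefficients become nonpositive at `K + 1` at the latest. -/
theorem coeff_fullSeries_succ_nonpos {n m K : ℕ} (hn : 1 ≤ n) (hnm : n ≤ m) (hK : K + 4 ≤ n)
    (hpos : ∀ i < K, 0 < quotCoeff n m i) (hneg : quotCoeff n m K ≤ 0) :
    PowerSeries.coeff (K + 1) (fullSeries n m) ≤ 0 := by
  obtain ⟨j, rfl⟩ : ∃ j, K = j + 2 := by
    rcases K with _ | _ | j
    · simp [quotCoeff_zero] at hneg
    · simp [quotCoeff_one] at hneg; lia
    · exact ⟨j, rfl⟩
  have ha := coeff_fullSeries_le hn hnm hpos j le_rfl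
  have hr := quotCoeff_recurrence n m j
  have h0 := hpos j (by lia)
  have h1 := hpos (j + 1) (by lia)
  rw [show j + 2 + 1 = j + 1 + 1 + 1 by rfl, coeff_succ_fullSeries, coeff_succ_fullSeries,
    coeff_succ_fullSeries]
  simp only [add_assoc, Nat.reduceAdd]
  -- The partial sum at j is at most 2b_j and b_{j+2} ≤ 0, so this combination bounds the partial
  -- sum at j + 3.
  have hs : ((j : ℤ) + 3) * (2 * quotCoeff n m j + quotCoeff n m (j + 1) + quotCoeff n m (j + 3))
      ≤ 0 := by
    have e0 : ((n : ℤ) - (j + 2)) * quotCoeff n m (j + 2) ≤ 0 :=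
      mul_nonpos_of_nonneg_of_nonpos (by lia) hneg
    have e1 : ((j : ℤ) + 3) * quotCoeff n m (j + 1) ≤ (2 * m + j + 1) * quotCoeff n m (j + 1) := by
      gcongr ?_ * _; lia
    have e2 : (2 * (j : ℤ) + 6) * quotCoeff n m j ≤ (2 * m - n + j) * quotCoeff n m j := by
      gcongr ?_ * _; lia
    linarith
  have := nonpos_of_mul_nonpos_right hs (by positivity)
  linarith

theorem coeff_three_fullSeries_nonpos {n m : ℕ} (hn : 1 ≤ n) (hn6 : n ≤ 6) (hnm : n ≤ m) :
    PowerSeries.coeff 3 (fullSeries n m) ≤ 0 := by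
  have h0 := quotCoeff_zero n m
  have h1 := quotCoeff_one n m
  have h2 := quotCoeff_two n m
  have h3 := quotCoeff_recurrence n m 0
  have ha := coeff_zero_fullSeries n m
  rw [coeff_succ_fullSeries, coeff_succ_fullSeries, coeff_succ_fullSeries, ha]
  simp only [zero_add, Nat.cast_zero, Nat.reduceAdd] at *
  rw [h0, h1] at *
  interval_cases n <;> norm_num at * <;> lia

theorem exists_coeff_fullSeries_nonpos {n m : ℕ} (hn : 1 ≤ n) (hnm : n ≤ m) :
    ∃ K : ℕ, PowerSeries.coeff (K + 1) (fullSeries n m) ≤ 0 ∧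
      (7 ≤ n → (∀ i < K, 0 < quotCoeff n m i) ∧ quotCoeff n m K ≤ 0) := by
  rcases Nat.lt_or_ge n 7 with h7 | h7
  · exact ⟨2, coeff_three_fullSeries_nonpos hn (by lia) hnm, fun h => by lia⟩
  · obtain ⟨i, hi, hneg⟩ := exists_quotCoeff_nonpos (k := (n - 4) / 4) hn hnm (by lia)
    classical
    have hex : ∃ i, quotCoeff n m i ≤ 0 := ⟨i, hneg⟩
    have hpos : ∀ i < Nat.find hex, 0 < quotCoeff n m i := fun i hi =>
      not_le.1 (Nat.find_min hex hi)
    have hle : Nat.find hex ≤ i := Nat.find_min' hex hneg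
    exact ⟨Nat.find hex, coeff_fullSeries_succ_nonpos hn hnm (by lia) hpos (Nat.find_spec hex),
      fun _ => ⟨hpos, Nat.find_spec hex⟩⟩

/-! ### The truncation -/

theorem truncHS_eq_coe_of_nonpos {n m j : ℕ}
    (hj : PowerSeries.coeff j (fullSeries n m) ≤ 0) :
    ((PowerSeries.trunc j (truncHS n m) : Polynomial ℤ) : PowerSeries ℤ) = truncHS n m := by
  ext d
  rw [Polynomial.coeff_coe, PowerSeries.coeff_trunc]
  split_ifs with h
  · rfl
  · rw [truncHS, posTrunc, PowerSeries.coeff_mk, if_neg]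
    exact fun h' => (h' j (not_lt.1 h)).not_ge hj

theorem natDegree_le_of_nonpos {n m j : ℕ} {P : Polynomial ℤ}
    (hP : (P : PowerSeries ℤ) = truncHS n m)
    (hj : PowerSeries.coeff (j + 1) (fullSeries n m) ≤ 0) : P.natDegree ≤ j := by
  rw [Polynomial.natDegree_le_iff_coeff_eq_zero]
  intro d hd
  rw [← Polynomial.coeff_coe, hP, truncHS, posTrunc, PowerSeries.coeff_mk, if_neg]
  exact fun h' => (h' (j + 1) hd).not_ge hj

theorem le_natDegree_of_pos {n m d : ℕ} {P : Polynomial ℤ}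
    (hP : (P : PowerSeries ℤ) = truncHS n m)
    (hd : ∀ i ≤ d, 0 < quotCoeff n m i) : d ≤ P.natDegree := by
  apply Polynomial.le_natDegree_of_ne_zero
  rw [← Polynomial.coeff_coe, hP, truncHS, posTrunc, PowerSeries.coeff_mk, if_pos]
  · exact (coeff_fullSeries_pos hd).ne'
  · exact fun i hi => coeff_fullSeries_pos fun j hj => hd j (hj.trans hi)

/-! ### The saddle point cubic -/

/-- For `y > 0` the sign of `saddleCubic α δ y` is that of
`y / (1 + y) - 2 * α * y ^ 2 / (1 + y ^ 2) - δ`. -/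
def saddleCubic (α δ y : ℝ) : ℝ :=
  y * (1 + y ^ 2) - 2 * α * y ^ 2 * (1 + y) - δ * ((1 + y) * (1 + y ^ 2))

theorem growthM_pos {α : ℝ} (hα : 1 ≤ α) : 0 < growthM α := by
  have hs : 0 ≤ α * (α + 2) := by positivity
  have hs0 := Real.sqrt_nonneg (α * (α + 2))
  have hs2 := Real.sq_sqrt hs
  rw [growthM]
  set s := Real.sqrt (α * (α + 2))
  have h1 : α ^ 2 + 3 * α + 1 < (α + 2) * s := by
    apply lt_of_pow_lt_pow_left₀ 2 (by positivity)
    rw [mul_pow, hs2]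
    nlinarith
  have h2 : 2 * α - 1 < Real.sqrt (2 * α ^ 2 - 10 * α - 1 + 2 * (α + 2) * s) := by
    apply Real.lt_sqrt_of_sq_lt
    nlinarith
  linarith

/-- At `δ = M(α)` the cubic has a double root in `(0, 1)`. -/
theorem exists_double_root {α : ℝ} (hα : 1 ≤ α) :
    ∃ τ : ℝ, 0 < τ ∧ τ < 1 ∧ saddleCubic α (growthM α) τ = 0 ∧
      3 * (1 - 2 * α - growthM α) * τ ^ 2 - 2 * (2 * α + growthM α) * τ
        + (1 - growthM α) = 0 := by
  have hs : 0 ≤ α * (α + 2) := by positivity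
  have hs0 := Real.sqrt_nonneg (α * (α + 2))
  have hs2 := Real.sq_sqrt hs
  rw [growthM]
  set s := Real.sqrt (α * (α + 2)) with hsdef
  have hs1 : 1 < s := by
    rw [hsdef]; apply Real.lt_sqrt_of_sq_lt; nlinarith
  -- Critical points of y/(1+y) - 2αy²/(1+y²) satisfy (1+y²)² = 4αy(1+y)², i.e. w² = 4α(w+2) for w =
  -- y + 1/y. Then v = 1/τ - τ.
  obtain ⟨w, hw⟩ : ∃ w, w = 2 * (α + s) := ⟨_, rfl⟩
  have hw2 : 2 < w := by linarith
  have hww : w ^ 2 = 4 * α * (w + 2) := by rw [hw]; linear_combination 4 * hs2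
  have hv0 : 0 < w ^ 2 - 4 := by nlinarith
  have hvpos := Real.sqrt_pos.2 hv0
  have hv2 := Real.sq_sqrt hv0.le
  set v := Real.sqrt (w ^ 2 - 4)
  have hαw : α = w ^ 2 / (4 * (w + 2)) := by field_simp; linarith
  have hsw : s = w / 2 - α := by linarith
  have hQ : Real.sqrt (2 * α ^ 2 - 10 * α - 1 + 2 * (α + 2) * s) =
      (w - 2) * v / (2 * (w + 2)) := by
    rw [Real.sqrt_eq_iff_mul_self_eq_of_pos (by have := sub_pos.2 hw2; positivity)]
    rw [hsw, hαw]
    field_simp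
    ring_nf
    have hv3 : v ^ 2 = w ^ 2 - 4 := hv2
    rw [hv3]
    ring
  rw [hQ]
  have hvw : v < w := by nlinarith
  have hvw' : w - 2 < v := by nlinarith
  obtain ⟨τ, hτ⟩ : ∃ τ, τ = (w - v) / 2 := ⟨_, rfl⟩
  have hv : v = w - 2 * τ := by linarith
  have hq : τ ^ 2 = w * τ - 1 := by rw [hv] at hv2; linarith
  refine ⟨τ, by linarith, by linarith, ?_, ?_⟩
  · rw [saddleCubic, hv, hαw]
    have hq3 : τ ^ 3 = w * (w * τ - 1) - τ := by linear_combination (τ + w) * hq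
    have hq4 : τ ^ 4 = w * τ ^ 3 - τ ^ 2 := by linear_combination τ ^ 2 * hq
    field_simp
    ring_nf
    simp only [hq4, hq3, hq]
    ring
  · rw [hv, hαw]
    have hq3 : τ ^ 3 = w * (w * τ - 1) - τ := by linear_combination (τ + w) * hq
    field_simp
    ring_nf
    simp only [hq3, hq]
    ring

/-- Taylor expansion at the double root τ leaves -(y-τ)² times a factor that is nonnegative for y ≥
0. -/
theorem saddleCubic_nonpos {α y : ℝ} (hα : 1 ≤ α) (hy : 0 ≤ y) :
    saddleCubic α (growthM α) y ≤ 0 := by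
  obtain ⟨τ, h0, -, hp, hp'⟩ := exists_double_root hα
  have hM := growthM_pos hα
  rw [saddleCubic] at hp ⊢
  generalize growthM α = M at *
  have h : y * (1 + y ^ 2) - 2 * α * y ^ 2 * (1 + y) - M * ((1 + y) * (1 + y ^ 2)) =
      -((y - τ) ^ 2 * ((2 * α + M - 1) * (y + 2 * τ) + (2 * α + M))) := by
    linear_combination hp + (y - τ) * hp'
  rw [h, neg_nonpos]
  have : 0 ≤ 2 * α + M - 1 := by linarith
  positivity

/-! ### Positivity below `M(α) n` -/

/-- For δ < M(α) the cubic is positive at τ, so the ratio bound τ reproduces itself through the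
recurrence. It starts from b_0 = 1 ≤ τn = τb_1. -/
theorem quotCoeff_pos_of_le {α ε τ : ℝ} {n m : ℕ} (hnm : n ≤ m) (hn : 1 ≤ n)
    (hm : (m : ℝ) ≤ α * n + 1) (hτ0 : 0 < τ) (hτ1 : τ < 1)
    (hτ : saddleCubic α (growthM α) τ = 0) (hε : 0 < ε) (hεn : 2 ≤ ε * n) (hτn : 1 ≤ τ * n)
    (k : ℕ) (hk : (k : ℝ) + 1 ≤ (growthM α - ε) * n) :
    0 < (quotCoeff n m k : ℝ) ∧ (quotCoeff n m k : ℝ) ≤ τ * quotCoeff n m (k + 1) := by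
  have hnm' : (n : ℝ) ≤ m := by exact_mod_cast hnm
  have hn' : (1 : ℝ) ≤ n := by exact_mod_cast hn
  rw [saddleCubic] at hτ
  -- The slack εn ≥ 2 absorbs the rounding of m and the index shifts.
  have key : ∀ k : ℝ, 0 ≤ k → k + 2 ≤ (growthM α - ε) * n →
      k + 2 ≤ τ * ((n - (k + 1)) - (2 * m + k) * τ - (2 * m - n + k - 1) * τ ^ 2) := by
    intro k hk0 hk
    have h1 : 0 ≤ (growthM α * n - ε * n - (k + 1)) * ((1 + τ) * (1 + τ ^ 2)) :=
      mul_nonneg (by linarith) (by positivity)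
    have h2 : (m : ℝ) * (2 * τ ^ 2 * (1 + τ)) ≤ (α * n + 1) * (2 * τ ^ 2 * (1 + τ)) := by gcongr
    have h3 : ε * n * 1 ≤ ε * n * ((1 + τ) * (1 + τ ^ 2)) := by
      gcongr
      nlinarith [sq_nonneg τ, pow_pos hτ0 3]
    nlinarith
  induction k using Nat.strong_induction_on with | _ k ih
  rcases k with _ | k
  · simp [quotCoeff_zero, quotCoeff_one, hτn]
  · push_cast at hk
    obtain ⟨hk0, hk1⟩ := ih k (by lia) (by linarith)
    have hpos : 0 < (quotCoeff n m (k + 1) : ℝ) :=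
      pos_of_mul_pos_right (hk0.trans_le hk1) hτ0.le
    refine ⟨hpos, ?_⟩
    have hkey := key k (by positivity) (by linarith)
    have hlow : ((n - (k + 1)) - (2 * m + k) * τ - (2 * m - n + k - 1) * τ ^ 2) *
        (quotCoeff n m (k + 1) : ℝ) ≤ (k + 2) * quotCoeff n m (k + 2) := by
      have e1 : (2 * (m : ℝ) + k) * quotCoeff n m k ≤
        (2 * m + k) * (τ * quotCoeff n m (k + 1)) := by gcongr
      have hc : 0 ≤ 2 * (m : ℝ) - n + k - 1 := by
        have : (0 : ℝ) ≤ k := by positivity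
        linarith
      rcases k with _ | k
      · have hr : (2 : ℝ) * quotCoeff n m 2 =
            (n - 1) * quotCoeff n m 1 - 2 * m * quotCoeff n m 0 := by
          exact_mod_cast quotCoeff_two n m
        have e2 : 0 ≤ (2 * (m : ℝ) - n + (0 : ℕ) - 1) * τ ^ 2 * quotCoeff n m (0 + 1) := by
          positivity
        simp only [zero_add, Nat.cast_zero] at *
        linarith
      · have hr : ((k : ℝ) + 3) * quotCoeff n m (k + 3) =
            ((n : ℝ) - (k + 2)) * quotCoeff n m (k + 2) -
              (2 * m + k + 1) * quotCoeff n m (k + 1) - (2 * m - n + k) * quotCoeff n m k := by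
          exact_mod_cast quotCoeff_recurrence n m k
        push_cast at hk hc e1 ⊢
        have e2 : (quotCoeff n m k : ℝ) ≤ τ * (τ * quotCoeff n m (k + 2)) :=
          (ih k (by lia) (by linarith)).2.trans (by gcongr)
        have e3 := mul_le_mul_of_nonneg_left e2 hc
        simp only [add_assoc, Nat.reduceAdd] at *
        linarith
    have h := mul_le_mul_of_nonneg_left hlow hτ0.le
    have h' := mul_le_mul_of_nonneg_right hkey hpos.le
    have : ((k : ℝ) + 2) * quotCoeff n m (k + 1) ≤ (k + 2) * (τ * quotCoeff n m (k + 2)) := by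
      linarith
    exact le_of_mul_le_mul_left this (by positivity)

/-! ### A sign change above `M(α) n` -/

/-- Above `M(α) n` every lower bound on the ratios of consecutive positive coefficients improves
by `ε` after two steps. -/
theorem mul_quotCoeff_succ_le {α ε : ℝ} {n m k₀ L : ℕ} (hα : 1 ≤ α) (hn : 1 ≤ n) (hnm : n ≤ m)
    (hm : α * n ≤ m) (hε : 0 < ε) (hk₀ : (growthM α + ε) * n ≤ k₀)
    (hpos : ∀ i ≤ L, 0 < quotCoeff n m i) (i j : ℕ) (hj : k₀ + 2 * i ≤ j) (hjL : j + 2 ≤ L) :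
    i * ε * (quotCoeff n m (j + 1) : ℝ) ≤ quotCoeff n m j := by
  have hpos' : ∀ i ≤ L, 0 < (quotCoeff n m i : ℝ) := fun i hi => by exact_mod_cast hpos i hi
  have hnm' : (n : ℝ) ≤ m := by exact_mod_cast hnm
  have hn' : (1 : ℝ) ≤ n := by exact_mod_cast hn
  induction i generalizing j with
  | zero => simpa using (hpos' j (by lia)).le
  | succ i ih =>
    obtain ⟨l, rfl⟩ : ∃ l, j = l + 2 := ⟨j - 2, by lia⟩
    have h1 := ih (l + 1) (by lia) (by lia)
    have h0 := ih l (by lia) (by lia)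
    have hdouble : 2 * (quotCoeff n m (l + 1) : ℝ) ≤ quotCoeff n m (l + 2) := by
      exact_mod_cast two_mul_quotCoeff_le hn hnm fun i hi => hpos i (by lia)
    have p1 := hpos' (l + 1) (by lia)
    have p2 := hpos' (l + 2) (by lia)
    have hr : ((l : ℝ) + 3) * quotCoeff n m (l + 3) =
        ((n : ℝ) - (l + 2)) * quotCoeff n m (l + 2) -
          (2 * m + l + 1) * quotCoeff n m (l + 1) - (2 * m - n + l) * quotCoeff n m l := by
      exact_mod_cast quotCoeff_recurrence n m l
    have hl : (growthM α + ε) * n ≤ (l : ℝ) + 2 :=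
      hk₀.trans (by exact_mod_cast (show k₀ ≤ l + 2 by lia))
    push_cast
    simp only [add_assoc, Nat.reduceAdd] at *
    rw [add_mul, one_mul]
    have hq0 : 0 ≤ i * ε := by positivity
    generalize (i : ℝ) * ε = q at *
    -- Doubling caps any lower bound on the ratios.
    have hq : q ≤ 1 / 2 := by
      have : 2 * q * quotCoeff n m (l + 2) ≤ 1 * quotCoeff n m (l + 2) := by linarith
      linarith [le_of_mul_le_mul_right this p2]
    have hcub := saddleCubic_nonpos hα hq0
    rw [saddleCubic] at hcub
    have hl0 : (0 : ℝ) ≤ l := by positivity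
    set B := ((n : ℝ) - (l + 2)) - (2 * m + l + 1) * q - (2 * m - n + l) * q ^ 2 with hB
    have hup : ((l : ℝ) + 3) * quotCoeff n m (l + 3) ≤ B * quotCoeff n m (l + 2) := by
      have hc : 0 ≤ 2 * (m : ℝ) - n + l := by linarith
      have e1 := mul_le_mul_of_nonneg_left h1 (show 0 ≤ 2 * (m : ℝ) + l + 1 by positivity)
      have e0 := mul_le_mul_of_nonneg_left
        ((mul_le_mul_of_nonneg_left h1 hq0).trans h0) hc
      linarith
    have hBn : ε * B ≤ ε * n := by
      gcongr
      have : 0 ≤ (2 * (m : ℝ) + l + 1) * q := by positivity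
      have : 0 ≤ (2 * (m : ℝ) - n + l) * q ^ 2 := mul_nonneg (by linarith) (by positivity)
      linarith
    -- The spare εn pays for raising q to q + ε, as B ≤ n. Index shifts cost q² + 2q³ ≤ 1/2.
    have hqB : q * B + ε * n ≤ l + 3 := by
      have e1 : 0 ≤ ((l : ℝ) + 2 - (growthM α + ε) * n) * ((1 + q) * (1 + q ^ 2)) :=
        mul_nonneg (by linarith) (by positivity)
      have e2 : α * n * (2 * q ^ 2 * (1 + q)) ≤ m * (2 * q ^ 2 * (1 + q)) := by gcongr
      have e3 : ε * n * 1 ≤ ε * n * ((1 + q) * (1 + q ^ 2)) := by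
        gcongr
        nlinarith [sq_nonneg q, pow_nonneg hq0 3]
      have e4 := mul_nonneg (sub_nonneg.2 hcub) (show (0 : ℝ) ≤ n by positivity)
      have e5 : q ^ 2 ≤ (1 / 2) ^ 2 := by gcongr
      have e6 : q ^ 3 ≤ (1 / 2) ^ 3 := by gcongr
      rw [hB]
      linarith
    have h2 := mul_le_mul_of_nonneg_left hup (show 0 ≤ q + ε by positivity)
    have h3 := mul_le_mul_of_nonneg_right
      (show (q + ε) * B ≤ l + 3 by linarith) p2.le
    have h4 : ((l : ℝ) + 3) * ((q + ε) * quotCoeff n m (l + 3)) ≤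
        (l + 3) * quotCoeff n m (l + 2) := by linarith
    exact le_of_mul_le_mul_left h4 (by positivity)

theorem exists_quotCoeff_nonpos_of_le {α ε : ℝ} {n m k₀ N : ℕ} (hα : 1 ≤ α) (hn : 1 ≤ n)
    (hnm : n ≤ m) (hm : α * n ≤ m) (hε : 0 < ε) (hk₀ : (growthM α + ε) * n ≤ k₀)
    (hN : 1 / 2 < N * ε) : ∃ i ≤ k₀ + 2 * N + 2, quotCoeff n m i ≤ 0 := by
  by_contra! hpos
  have h := mul_quotCoeff_succ_le hα hn hnm hm hε hk₀ hpos N (k₀ + 2 * N) le_rfl le_rfl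
  have hdouble : 2 * (quotCoeff n m (k₀ + 2 * N) : ℝ) ≤ quotCoeff n m (k₀ + 2 * N + 1) := by
    exact_mod_cast two_mul_quotCoeff_le hn hnm fun i hi => hpos i (by lia)
  have hp : 0 < (quotCoeff n m (k₀ + 2 * N + 1) : ℝ) := by exact_mod_cast hpos _ (by lia)
  have := mul_lt_mul_of_pos_right hN hp
  linarith

/-! ### The asymptotics of the degree -/

theorem eventually_abs_natDegree_sub_le {α ε : ℝ} (hα : 1 ≤ α) (hε : 0 < ε)
    {P : ℕ → Polynomial ℤ}
    (hP : ∀ n : ℕ, 1 ≤ n → (P n : PowerSeries ℤ) = truncHS n ⌈α * (n : ℝ)⌉₊) :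
    ∀ᶠ n : ℕ in atTop, |((P n).natDegree : ℝ) - growthM α * n| ≤ 2 * ε * n := by
  obtain ⟨τ, hτ0, hτ1, hτ, -⟩ := exists_double_root hα
  obtain ⟨N, hN⟩ := exists_nat_gt (1 / 2 / ε)
  rw [div_lt_iff₀ hε] at hN
  have hlim : ∀ c : ℝ, 0 < c → Tendsto (fun n : ℕ => c * (n : ℝ)) atTop atTop := fun c hc =>
    tendsto_natCast_atTop_atTop.const_mul_atTop hc
  -- N depends on ε only, so the 2N + 3 extra indices fit into a second εn.
  filter_upwards [eventually_ge_atTop 7, (hlim ε hε).eventually_ge_atTop (2 * N + 3),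
    (hlim τ hτ0).eventually_ge_atTop 1] with n hn7 hεn hτn
  have hm1 : α * n ≤ ⌈α * (n : ℝ)⌉₊ := Nat.le_ceil _
  have hm2 : (⌈α * (n : ℝ)⌉₊ : ℝ) ≤ α * n + 1 := (Nat.ceil_lt_add_one (by positivity)).le
  have hPn := hP n (by lia)
  generalize ⌈α * (n : ℝ)⌉₊ = m at *
  have hnm : n ≤ m := by
    have : (n : ℝ) ≤ m := le_trans (le_mul_of_one_le_left (by positivity) hα) hm1
    exact_mod_cast this
  have hN0 : (0 : ℝ) ≤ N := by positivity
  obtain ⟨K, hK, hK'⟩ := exists_coeff_fullSeries_nonpos (show 1 ≤ n by lia) hnm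
  obtain ⟨hpos, hneg⟩ := hK' hn7
  have hK0 : K ≠ 0 := by
    rintro rfl
    simp [quotCoeff_zero] at hneg
  have hlow : (growthM α - ε) * n < K + 1 := by
    by_contra! h
    have := (quotCoeff_pos_of_le hnm (by lia) hm2 hτ0 hτ1 hτ hε (by linarith) hτn K h).1
    exact this.not_ge (by exact_mod_cast hneg)
  have hup : (K : ℝ) ≤ (growthM α + ε) * n + 2 * N + 3 := by
    obtain ⟨i, hi, hi'⟩ := exists_quotCoeff_nonpos_of_le hα (show 1 ≤ n by lia) hnm hm1 hε
      (Nat.le_ceil _) hN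
    have hKi : K ≤ i := not_lt.1 fun h => (hpos i h).not_ge hi'
    have hceil := Nat.ceil_lt_add_one (a := (growthM α + ε) * n)
      (mul_nonneg (add_pos (growthM_pos hα) hε).le (by positivity))
    have : (K : ℝ) ≤ ⌈(growthM α + ε) * n⌉₊ + 2 * N + 2 := by exact_mod_cast hKi.trans hi
    linarith
  have hd1 : ((P n).natDegree : ℝ) ≤ K := by exact_mod_cast natDegree_le_of_nonpos hPn hK
  have hd2 : (K : ℝ) ≤ (P n).natDegree + 1 := by
    have := le_natDegree_of_pos (d := K - 1) hPn fun i hi => hpos i (by lia)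
    exact_mod_cast (show K ≤ (P n).natDegree + 1 by lia)
  have hεn2 : 2 ≤ ε * n := by linarith
  rw [abs_le]
  constructor <;> linarith

theorem mainTheorem3 (α : ℝ) (hα : 1 ≤ α) :
    ∃ P : ℕ → Polynomial ℤ,
      (∀ n : ℕ, 1 ≤ n → (P n : PowerSeries ℤ) = truncHS n ⌈α * (n : ℝ)⌉₊) ∧
      (fun n : ℕ => ((P n).natDegree : ℝ)) ~[atTop] (fun n : ℕ => growthM α * (n : ℝ)) := by
  have hex : ∀ n : ℕ, ∃ p : Polynomial ℤ, 1 ≤ n →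
      (p : PowerSeries ℤ) = truncHS n ⌈α * (n : ℝ)⌉₊ := by
    intro n
    by_cases hn : 1 ≤ n
    · have hnm : n ≤ ⌈α * (n : ℝ)⌉₊ := by
        have : (n : ℝ) ≤ ⌈α * (n : ℝ)⌉₊ :=
          (le_mul_of_one_le_left (by positivity) hα).trans (Nat.le_ceil _)
        exact_mod_cast this
      obtain ⟨K, hK, -⟩ := exists_coeff_fullSeries_nonpos hn hnm
      exact ⟨_, fun _ => truncHS_eq_coe_of_nonpos hK⟩
    · exact ⟨0, fun h => absurd h hn⟩
  choose P hP using hex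
  refine ⟨P, hP, ?_⟩
  have hM := growthM_pos hα
  rw [IsEquivalent, isLittleO_iff]
  intro c hc
  filter_upwards [eventually_abs_natDegree_sub_le hα (show 0 < c * growthM α / 2 by positivity) hP]
    with n hn
  rw [Pi.sub_apply, Real.norm_eq_abs, Real.norm_of_nonneg (by positivity)]
  linarith
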